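/- **Model.** Time is slotted. One LLM engine has a token budget $b\in\mathbb N$, and a batch of $k$ tokens takes $t_k\ge 1$ slots ($k\mapsto t_k$ is an arbitrary function with positive integer values). It serves requests of two types $j\in\{1,2\}$. In each slot a finite ordered list of requests arrives; the lists of the types of these requests are i.i.d. over the slots, and $\lambda^j$ denotes the mean number of type-$j$ requests per slot. Independently of everything else, a type-$j$ request has a random triple (number of prefill tokens $v_p\ge 1$, number of decode tokens $v_d\ge 1$, feature in a finite set), with a law depending only on $j$; $m^j_p$ and $m^j_d$ are the means of $v_p$ and $v_d$. All of $\lambda^j,m^j_p,m^j_d$ are assumed finite. The state is $x=(r,(p_i,d_i,z_i)_{i\in\mathcal Q})$: $r$ is the remaining processing time of the current batch, and the requests present, each with its type, are listed from oldest to youngest with their numbers $p_i,d_i$ of not yet loaded prefill and decode tokens and their features $z_i$. A scheduling algorithm $\pi$ chooses, as a function of the state, numbers $(\delta^p_i,\delta^d_i)_{i\in\mathcal Q}$ of tokens to load, such that $\delta_i^d=0$ if $p_i>0$, $\delta^p_i\le p_i$, $\delta^d_i\le 1$, $b'=\sum_i(\delta^p_i+\delta^d_i)\le b$, and $b'=0$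 if $r>0$. Loaded tokens are subtracted, requests with no unprocessed decode tokens leave, the new requests of the slot are appended, and $r$ becomes $r-1$ if $r>0$ and $t_{b'}-1$ if $r=0$. This defines a discrete-time Markov chain. The algorithm is *$(K_p,K_d)$-FCFS* if prefill tokens are loaded only from the $K_p$ oldest requests with $p_i>0$, and decode tokens only from the $K_d$ oldest requests with $p_i=0$. It is *work-conserving* if, whenever $r=0$, the batch is full ($b'=b$) when $\sum_i(p_i+1(p_i=0))\ge b$, and contains all loadable tokens ($b'=\sum_i(p_i+1(p_i=0))$) otherwise. **Fluid model.** A fluid model solution consists of functions $B^j_f,F^j_f,W^j_f,Z^j_f$ on $[0,\infty)$, $j\in\{1,2\}$, $f\in\{p,d\}$, with $Z^j_f\ge 0$ and $$Z^j_p(t)=Z^j_p(0)+\lambda^jt-F^j_p(t),\qquad Z^j_d(t)=Z^j_d(0)+F^j_p(t)-F^j_d(t),$$ $$B^j_f(0)=0,\qquad 0\le B^j_f(t)-B^j_f(s)\le (t-s)\,b/t_b\ \ (0\le s\le t),\qquad F^j_f=B^j_f/m^j_f,\qquad W^j_f=m^j_fZ^j_f.$$ It is work-conserving if, at each $t>0$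 at which all components are differentiable, $\sum_{j}(W^j_p(t)+W^j_d(t))>0$ implies $\sum_{j}(\dot B^j_p(t)+\dot B^j_d(t))=b/t_b$. The fluid model (under work-conserving algorithms) is *stable* if there is $\delta>0$ such that every work-conserving fluid model solution with $\sum_{j}(Z^j_p(0)+Z^j_d(0))\le 1$ satisfies $Z^j_f(t)=0$ for all $j$, $f$ and all $t\ge\delta$. **Claim.** Assume $$\sum_{j\in\{1,2\}}\lambda^j(m^j_p+m^j_d)<b/t_b.$$ Then the fluid model is stable. Moreover, for all integers $K_p,K_d\ge 1$, every work-conserving $(K_p,K_d)$-FCFS algorithm and every initial state $x_0$, if the Markov chain is irreducible on the set $\mathcal X$ of states that it can reach from $x_0$, then it is positive recurrent: every state in $\mathcal X$ has a finite expected return time. (Feasibility, the FCFS property and work conservation are required only at the states in $\mathcal X$.) -/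

import Mathlib

open MeasureTheory ProbabilityTheory
open scoped ENNReal

/-! ### Markov chains on a discrete state space -/

namespace DTMC

/-- One-step kernel of the time-homogeneous chain with transition law `P`, as a kernel from
histories `(x₀, …, xₙ)` to the next state.  The state space carries the discrete `σ`-algebra. -/
noncomputable def stepKernel {S : Type*} [MeasurableSpace S] [DiscreteMeasurableSpace S]
    (P : S → PMF S) (n : ℕ) : Kernel ((i : Finset.Iic n) → S) S where
  toFun h := (P (h ⟨n, Finset.mem_Iic.2 le_rfl⟩)).toMeasure
  measurable' :=
    (Measurable.of_discrete (f := fun x : S => (P x).toMeasure)).comp (measurable_pi_apply _)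

instance {S : Type*} [MeasurableSpace S] [DiscreteMeasurableSpace S]
    (P : S → PMF S) (n : ℕ) : IsMarkovKernel (stepKernel P n) where
  isProbabilityMeasure h :=
    inferInstanceAs (IsProbabilityMeasure (P (h ⟨n, Finset.mem_Iic.2 le_rfl⟩)).toMeasure)

/-- The law on trajectories `ℕ → S` of the Markov chain with transition law `P` started at `x`. -/
noncomputable def pathLaw {S : Type*} [MeasurableSpace S] [DiscreteMeasurableSpace S]
    (P : S → PMF S) (x : S) : Measure (ℕ → S) :=
  Kernel.traj (X := fun _ => S) (stepKernel P) 0 (fun _ => x)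

/-- The first time `n ≥ 1` at which a trajectory is at `x` (`∞` if there is none). -/
noncomputable def returnTime {S : Type*} (x : S) (ω : ℕ → S) : ℝ≥0∞ :=
  ⨅ (n : ℕ) (_ : 1 ≤ n ∧ ω n = x), (n : ℝ≥0∞)

/-- Expected return time to `x` of the chain started at `x`. -/
noncomputable def meanReturnTime {S : Type*} [MeasurableSpace S] [DiscreteMeasurableSpace S]
    (P : S → PMF S) (x : S) : ℝ≥0∞ :=
  ∫⁻ ω, returnTime x ω ∂(pathLaw P x)

/-- The states that the chain started at `x` visits with positive probability. -/
def reachable {S : Type*} (P : S → PMF S) (x : S) : Set S :=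
  {y | Relation.ReflTransGen (fun u v => v ∈ (P u).support) x y}

/-- The chain started at `x₀` is irreducible: all states it can take communicate. -/
def IsIrreducibleFrom {S : Type*} (P : S → PMF S) (x₀ : S) : Prop :=
  ∀ x ∈ reachable P x₀, ∀ y ∈ reachable P x₀, y ∈ reachable P x

/-- The chain started at `x₀` is positive recurrent: each state it can take has a finite expected
return time. -/
def IsPositiveRecurrentFrom {S : Type*} [MeasurableSpace S] [DiscreteMeasurableSpace S]
    (P : S → PMF S) (x₀ : S) : Prop :=
  ∀ x ∈ reachable P x₀, meanReturnTime P x < ∞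

end DTMC

namespace LLM

/-- The two phases of a request. -/
inductive Phase where
  | prefill
  | decode

/-! ### The stochastic model: one engine, two request types -/

/-- A request in the system: its type, its numbers of unprocessed (not yet loaded) prefill and
decode tokens, and its feature. -/
structure Request (κ : Type*) where
  type : Fin 2
  prefill : ℕ
  decode : ℕ
  feature : κ

/-- System state at the beginning of a slot: the remaining processing time of the current batch,
and the requests that have not departed, listed from the oldest to the youngest. -/
structure State (κ : Type*) where
  remaining : ℕ
  queue : List (Request κ)

instance {κ : Type*} : MeasurableSpace (State κ) := ⊤

instance {κ : Type*} : DiscreteMeasurableSpace (State κ) := ⟨fun _ => trivial⟩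

/-- Primitive data of an engine serving two types of requests. -/
structure Engine (κ : Type*) where
  /-- token budget `b` -/
  budget : ℕ
  /-- `batchTime k` is the number of slots needed to process a batch with `k` tokens -/
  batchTime : ℕ → ℕ
  batchTime_pos : ∀ k, 1 ≤ batchTime k
  /-- law of the list of the types of the requests arriving in one slot, in order of arrival -/
  arrivalLaw : PMF (List (Fin 2))
  /-- law of (prefill tokens, decode tokens, feature) of a request of a given type -/
  sizeLaw : Fin 2 → PMF (ℕ × ℕ × κ)
  prefill_pos : ∀ j, ∀ s ∈ (sizeLaw j).support, 1 ≤ s.1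
  decode_pos : ∀ j, ∀ s ∈ (sizeLaw j).support, 1 ≤ s.2.1

/-- Mean, in `[0, ∞]`, of the function `g` under the law `μ`. -/
noncomputable def pmfMean {α : Type*} (μ : PMF α) (g : α → ℕ) : ℝ≥0∞ :=
  ∑' a, μ a * (g a : ℝ≥0∞)

/-- A scheduling algorithm assigns to each state the numbers `(δᵖ, δᵈ)` of prefill and decode
tokens of each request that are loaded into a batch. -/
abbrev Algorithm (κ : Type*) := (x : State κ) → Fin x.queue.length → ℕ × ℕ

/-- Number `b'` of tokens loaded in state `x`. -/
def tokenLoad {κ : Type*} (π : Algorithm κ) (x : State κ) : ℕ :=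
  ∑ i, ((π x i).1 + (π x i).2)

/-- Number of tokens that could be loaded in state `x` if there were no token budget: all the
unprocessed prefill tokens, and one decode token of each request in the decode phase. -/
def loadable {κ : Type*} (x : State κ) : ℕ :=
  ∑ i : Fin x.queue.length, (x.queue[i].prefill + if x.queue[i].prefill = 0 then 1 else 0)

/-- Feasibility of the decision in state `x` under token budget `b`. -/
structure IsFeasibleAt {κ : Type*} (b : ℕ) (π : Algorithm κ) (x : State κ) : Prop where
  busy : 0 < x.remaining → tokenLoad π x = 0
  prefill_first : ∀ i, 0 < x.queue[i].prefill → (π x i).2 = 0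
  prefill_le : ∀ i, (π x i).1 ≤ x.queue[i].prefill
  decode_le : ∀ i, (π x i).2 ≤ 1
  budget : tokenLoad π x ≤ b

/-- Work conservation in state `x`: when a batch can be formed, it is full if there are enough
loadable tokens, and otherwise no loadable token is left out. -/
structure IsWorkConservingAt {κ : Type*} (b : ℕ) (π : Algorithm κ) (x : State κ) : Prop where
  full : x.remaining = 0 → b ≤ loadable x → tokenLoad π x = b
  exhaustive : x.remaining = 0 → loadable x < b → tokenLoad π x = loadable x

/-- `(K_p, K_d)`-FCFS in state `x`: prefill tokens are loaded only from the `K_p` oldest requests in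
the prefill phase, decode tokens only from the `K_d` oldest requests in the decode phase. -/
structure IsFCFSAt {κ : Type*} (Kp Kd : ℕ) (π : Algorithm κ) (x : State κ) : Prop where
  prefill : ∀ i, 0 < (π x i).1 →
    (Finset.univ.filter fun k => k < i ∧ 0 < x.queue[k].prefill).card < Kp
  decode : ∀ i, 0 < (π x i).2 →
    (Finset.univ.filter fun k => k < i ∧ x.queue[k].prefill = 0).card < Kd

/-- The requests present after the decision in state `x`: loaded tokens are subtracted, and the
requests without unprocessed decode tokens are removed. -/
def postQueue {κ : Type*} (π : Algorithm κ) (x : State κ) : List (Request κ) :=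
  (List.ofFn fun i : Fin x.queue.length =>
    { x.queue[i] with
      prefill := x.queue[i].prefill - (π x i).1
      decode := x.queue[i].decode - (π x i).2 }).filter fun r => r.decode ≠ 0

namespace Engine

variable {κ : Type*}

/-- Arrival rate `λʲ` of type `j`, in `[0, ∞]`. -/
noncomputable def erate (M : Engine κ) (j : Fin 2) : ℝ≥0∞ :=
  pmfMean M.arrivalLaw fun l => l.count j

/-- Mean token sizes `mʲ_p` and `mʲ_d` of type `j`, in `[0, ∞]`. -/
noncomputable def emeanSize (M : Engine κ) (j : Fin 2) : Phase → ℝ≥0∞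
  | .prefill => pmfMean (M.sizeLaw j) fun s => s.1
  | .decode => pmfMean (M.sizeLaw j) fun s => s.2.1

/-- First-moment assumption. -/
structure FiniteMeans (M : Engine κ) : Prop where
  rate : ∀ j, M.erate j ≠ ∞
  size : ∀ j f, M.emeanSize j f ≠ ∞

/-- Arrival rate `λʲ` as a real number. -/
noncomputable def rate (M : Engine κ) (j : Fin 2) : ℝ := (M.erate j).toReal

/-- Mean token size `mʲ_f` as a real number. -/
noncomputable def meanSize (M : Engine κ) (j : Fin 2) (f : Phase) : ℝ := (M.emeanSize j f).toReal

/-- Maximal token processing rate `b / t_b`. -/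
noncomputable def capacity (M : Engine κ) : ℝ := (M.budget : ℝ) / (M.batchTime M.budget : ℝ)

/-- Law of the requests arriving in a slot, given their types: the sizes and features are
independent, those of a request of type `j` having law `sizeLaw j`. -/
noncomputable def drawRequests (M : Engine κ) : List (Fin 2) → PMF (List (Request κ))
  | [] => PMF.pure []
  | j :: js =>
    (M.sizeLaw j).bind fun s => (drawRequests M js).map fun l => ⟨j, s.1, s.2.1, s.2.2⟩ :: l

/-- Law of the list of requests arriving in one slot. -/
noncomputable def newRequests (M : Engine κ) : PMF (List (Request κ)) :=
  M.arrivalLaw.bind M.drawRequests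

/-- Remaining processing time at the beginning of the next slot. -/
def nextRemaining (M : Engine κ) (π : Algorithm κ) (x : State κ) : ℕ :=
  if 0 < x.remaining then x.remaining - 1 else M.batchTime (tokenLoad π x) - 1

/-- Transition law of the Markov chain describing the engine under the algorithm `π`. -/
noncomputable def transition (M : Engine κ) (π : Algorithm κ) (x : State κ) : PMF (State κ) :=
  M.newRequests.map fun new => ⟨M.nextRemaining π x, postQueue π x ++ new⟩

end Engine

/-! ### The fluid model -/

/-- The components `B, F, W, Z` of a fluid model solution, indexed by the type, the phase and the
time `t`; only times `t ≥ 0` matter. -/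
structure FluidPath where
  B : Fin 2 → Phase → ℝ → ℝ
  F : Fin 2 → Phase → ℝ → ℝ
  W : Fin 2 → Phase → ℝ → ℝ
  Z : Fin 2 → Phase → ℝ → ℝ

/-- Fluid model equations with arrival rates `rate j`, mean token sizes `m j f` and maximal token
processing rate `c`. -/
structure IsFluidSolution (rate : Fin 2 → ℝ) (m : Fin 2 → Phase → ℝ) (c : ℝ) (X : FluidPath) :
    Prop where
  Z_nonneg : ∀ j f t, 0 ≤ t → 0 ≤ X.Z j f t
  Z_prefill : ∀ j t, 0 ≤ t →
    X.Z j .prefill t = X.Z j .prefill 0 + rate j * t - X.F j .prefill t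
  Z_decode : ∀ j t, 0 ≤ t →
    X.Z j .decode t = X.Z j .decode 0 + X.F j .prefill t - X.F j .decode t
  B_zero : ∀ j f, X.B j f 0 = 0
  B_mono : ∀ j f s t, 0 ≤ s → s ≤ t → 0 ≤ X.B j f t - X.B j f s
  B_rate : ∀ j f s t, 0 ≤ s → s ≤ t → X.B j f t - X.B j f s ≤ (t - s) * c
  F_eq : ∀ j f t, 0 ≤ t → X.F j f t = 1 / m j f * X.B j f t
  W_eq : ∀ j f t, 0 ≤ t → X.W j f t = m j f * X.Z j f t

/-- `t > 0` is a regular point if all components are differentiable at `t`. -/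
def FluidPath.IsRegular (X : FluidPath) (t : ℝ) : Prop :=
  0 < t ∧ ∀ j f, DifferentiableAt ℝ (X.B j f) t ∧ DifferentiableAt ℝ (X.F j f) t ∧
    DifferentiableAt ℝ (X.W j f) t ∧ DifferentiableAt ℝ (X.Z j f) t

/-- Work conservation: tokens are processed at the maximal rate `c` whenever there are any. -/
def FluidPath.IsWorkConserving (c : ℝ) (X : FluidPath) : Prop :=
  ∀ t, X.IsRegular t → 0 < ∑ j, (X.W j .prefill t + X.W j .decode t) →
    ∑ j, (deriv (X.B j .prefill) t + deriv (X.B j .decode) t) = c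

/-- Stability of the work-conserving fluid model. -/
def FluidModelStable (rate : Fin 2 → ℝ) (m : Fin 2 → Phase → ℝ) (c : ℝ) : Prop :=
  ∃ δ : ℝ, 0 < δ ∧ ∀ X : FluidPath, IsFluidSolution rate m c X → X.IsWorkConserving c →
    ∑ j, (X.Z j .prefill 0 + X.Z j .decode 0) ≤ 1 → ∀ t, δ ≤ t → ∀ j f, X.Z j f t = 0

end LLM

open scoped NNReal

/-! Both halves rest on the total amount of unprocessed work, counted in tokens: it grows at mean
rate `a = ∑ λ(m_p + m_d)` and, at full effort, shrinks at rate `c = b / t_b > a`.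

In the fluid model, weight prefill fluid by `m_p + m_d` and decode fluid by `m_d`. The resulting
backlog decreases at rate exactly `c - a` while positive, so it reaches zero within a uniformly
bounded time and stays there (`work_sub_eq`, `backlog_nonpos_of_le`).

For the Markov chain, Foster's criterion is applied directly, without fluid limits. Token count
alone is not enough, for two reasons. Tokens leave the count only when a batch starts, so a multiple
`γ` of the remaining batch time is added to spread the gain over the batch's slots. Also, when few
tokens are loadable, a batch may be small although some request still has many decode tokens. By
work conservation such a batch loads everything loadable, so every request loses at least one token;
hence the largest excess over a level `L`, weighted by a large `β`, decreases
(`maxExcess_postQueue_le_sub_one`). New requests raise this excess by at most `(tokens - L)⁺`, whose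
mean is small for large `L` since first moments are finite (`exists_expect_tsub_le`). The drift
fails only at batch starts with fewer than `b` loadable tokens and all requests of size at most `L`,
which is a finite set (`lyapunov_next_add_le`, `finite_setOf_loadable_lt`). -/

namespace DTMC

/-- Expectation of an `[0, ∞]`-valued function under a discrete law. -/
noncomputable def expect {α : Type*} (μ : PMF α) (g : α → ℝ≥0∞) : ℝ≥0∞ := ∑' a, μ a * g a

/-! ### Expectations under discrete laws -/

section Expect

variable {α β : Type*} (μ : PMF α)

lemma expect_mono_support {g h : α → ℝ≥0∞} (hgh : ∀ a ∈ μ.support, g a ≤ h a) :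
    expect μ g ≤ expect μ h := by
  refine ENNReal.tsum_le_tsum fun a => ?_
  by_cases ha : μ a = 0
  · simp [ha]
  · gcongr
    exact hgh a ((μ.mem_support_iff a).2 ha)

lemma expect_mono {g h : α → ℝ≥0∞} (hgh : ∀ a, g a ≤ h a) : expect μ g ≤ expect μ h :=
  expect_mono_support μ fun a _ => hgh a

@[simp]
lemma expect_const (c : ℝ≥0∞) : expect μ (fun _ => c) = c := by
  simp [expect, ENNReal.tsum_mul_right, μ.tsum_coe]

lemma expect_add (g h : α → ℝ≥0∞) :
    expect μ (fun a => g a + h a) = expect μ g + expect μ h := by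
  simp [expect, mul_add, ENNReal.tsum_add]

lemma expect_const_mul (c : ℝ≥0∞) (g : α → ℝ≥0∞) :
    expect μ (fun a => c * g a) = c * expect μ g := by
  simp [expect, ← ENNReal.tsum_mul_left, mul_left_comm]

lemma expect_sum {ι : Type*} (s : Finset ι) (g : ι → α → ℝ≥0∞) :
    expect μ (fun a => ∑ i ∈ s, g i a) = ∑ i ∈ s, expect μ (g i) := by
  classical
  induction s using Finset.induction_on with
  | empty => simp
  | insert i s hi ih => simp [Finset.sum_insert hi, expect_add, ih]

lemma expect_pure (a : α) (g : α → ℝ≥0∞) : expect (PMF.pure a) g = g a := by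
  rw [expect, tsum_eq_single a]
  · simp
  · intro b hb
    simp [hb]

lemma expect_bind (f : α → PMF β) (g : β → ℝ≥0∞) :
    expect (μ.bind f) g = expect μ fun a => expect (f a) g := by
  simp only [expect, PMF.bind_apply, ← ENNReal.tsum_mul_right, ← ENNReal.tsum_mul_left]
  rw [ENNReal.tsum_comm]
  simp [mul_assoc]

lemma expect_map (f : α → β) (g : β → ℝ≥0∞) :
    expect (μ.map f) g = expect μ fun a => g (f a) := by
  rw [PMF.map, expect_bind]
  simp [expect_pure]

lemma lintegral_toMeasure [MeasurableSpace α] [DiscreteMeasurableSpace α] (g : α → ℝ≥0∞) :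
    ∫⁻ a, g a ∂μ.toMeasure = expect μ g := by
  rw [← μ.restrict_toMeasure_support, lintegral_countable _ μ.support_countable]
  rw [tsum_subtype μ.support fun a => g a * μ.toMeasure {a}, expect]
  refine tsum_congr fun a => ?_
  by_cases ha : a ∈ μ.support
  · rw [Set.indicator_of_mem ha, μ.toMeasure_apply_singleton a (MeasurableSet.singleton a),
      mul_comm]
  · simp [ha, (μ.apply_eq_zero_iff a).2 ha]

end Expect

variable {S : Type*}

open Classical in
/-- Taboo transition operator: one step of the chain, killed when it enters `x`. -/
noncomputable def taboo (P : S → PMF S) (x : S) (u : S → ℝ≥0∞) (y : S) : ℝ≥0∞ :=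
  expect (P y) fun z => if z = x then 0 else u z

/-- Expected time before the first return to `x`, truncated at `n`. -/
noncomputable def truncReturn (P : S → PMF S) (x : S) (n : ℕ) (y : S) : ℝ≥0∞ :=
  ∑ k ∈ Finset.range n, (taboo P x)^[k] 1 y

/-! ### The taboo operator and truncated return times -/

section Taboo

variable (P : S → PMF S) (x : S)

lemma taboo_le_expect (u : S → ℝ≥0∞) (y : S) : taboo P x u y ≤ expect (P y) u :=
  expect_mono _ fun z => by split_ifs <;> simp

lemma taboo_mono_support {u v : S → ℝ≥0∞} {y : S} (h : ∀ z ∈ (P y).support, u z ≤ v z) :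
    taboo P x u y ≤ taboo P x v y :=
  expect_mono_support _ fun z hz => by split_ifs <;> simp [h z hz]

lemma taboo_add (u v : S → ℝ≥0∞) : taboo P x (u + v) = taboo P x u + taboo P x v := by
  funext y
  simp only [taboo, Pi.add_apply, ← expect_add]
  congr 1
  funext z
  split_ifs <;> simp

lemma taboo_smul (c : ℝ≥0∞) (u : S → ℝ≥0∞) : taboo P x (c • u) = c • taboo P x u := by
  funext y
  simp only [taboo, Pi.smul_apply, smul_eq_mul, ← expect_const_mul]
  congr 1
  funext z
  split_ifs <;> simp

lemma taboo_sum {ι : Type*} (s : Finset ι) (u : ι → S → ℝ≥0∞) :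
    taboo P x (fun z => ∑ i ∈ s, u i z) = fun y => ∑ i ∈ s, taboo P x (u i) y := by
  funext y
  simp only [taboo, ← expect_sum]
  congr 1
  funext z
  split_ifs <;> simp

lemma taboo_iterate_add (n : ℕ) (u v : S → ℝ≥0∞) :
    (taboo P x)^[n] (u + v) = (taboo P x)^[n] u + (taboo P x)^[n] v := by
  induction n generalizing u v with
  | zero => rfl
  | succ n ih => simp [taboo_add, ih]

lemma taboo_iterate_smul (n : ℕ) (c : ℝ≥0∞) (u : S → ℝ≥0∞) :
    (taboo P x)^[n] (c • u) = c • (taboo P x)^[n] u := by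
  induction n generalizing u with
  | zero => rfl
  | succ n ih => simp [taboo_smul, ih]

lemma truncReturn_succ (n : ℕ) (y : S) :
    truncReturn P x (n + 1) y = 1 + taboo P x (truncReturn P x n) y := by
  have h := congrFun (taboo_sum P x (Finset.range n) fun k => (taboo P x)^[k] 1) y
  rw [truncReturn, Finset.sum_range_succ', add_comm]
  simp only [Function.iterate_succ_apply']
  exact congrArg _ h.symm

lemma truncReturn_mono (y : S) : Monotone fun n => truncReturn P x n y :=
  fun _ _ h => Finset.sum_le_sum_of_subset (by simpa using h)

lemma truncReturn_le (n : ℕ) (y : S) : truncReturn P x n y ≤ n := by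
  induction n generalizing y with
  | zero => simp [truncReturn]
  | succ n ih =>
    rw [truncReturn_succ, Nat.cast_succ, add_comm]
    gcongr
    refine (taboo_le_expect P x _ y).trans ((expect_mono _ ih).trans ?_)
    simp

lemma truncReturn_add (k n : ℕ) (y : S) :
    truncReturn P x (k + n) y
      = truncReturn P x k y + (taboo P x)^[k] (truncReturn P x n) y := by
  induction k generalizing y with
  | zero => simp [truncReturn]
  | succ k ih =>
    have : truncReturn P x (k + n)
        = truncReturn P x k + (taboo P x)^[k] (truncReturn P x n) := funext ih
    rw [Nat.succ_add, truncReturn_succ, truncReturn_succ, Function.iterate_succ_apply', this,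
      taboo_add, Pi.add_apply, add_assoc]

end Taboo

lemma expect_lt_one (μ : PMF S) {g : S → ℝ≥0∞} (hg : ∀ z, g z ≤ 1) {z : S} (hz : z ∈ μ.support)
    (h : g z < 1) : expect μ g < 1 := by
  have hlt : expect μ g < expect μ fun _ => 1 := by
    refine ENNReal.tsum_lt_tsum (i := z) ?_ (fun a => by gcongr; exact hg a) ?_
    · exact ((expect_mono μ hg).trans_lt (by simp)).ne
    · exact ENNReal.mul_lt_mul_right ((μ.mem_support_iff z).1 hz) (μ.apply_ne_top z) h
  simpa using hlt

lemma taboo_iterate_one_le (P : S → PMF S) (x : S) (k : ℕ) (y : S) :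
    (taboo P x)^[k] 1 y ≤ 1 := by
  induction k generalizing y with
  | zero => simp
  | succ k ih =>
    rw [Function.iterate_succ_apply']
    refine (taboo_le_expect P x _ y).trans ((expect_mono _ ih).trans ?_)
    simp

/-- The iterate is the probability of avoiding `x` for `k` steps. Along a path to `x`, the last step
hits `x` with positive probability, and each earlier step carries the strict inequality one state
back. -/
lemma taboo_iterate_lt_one_of_reachable {P : S → PMF S} {x y : S} (h : x ∈ reachable P y)
    (hyx : y ≠ x) : ∃ k, (taboo P x)^[k] 1 y < 1 := by
  induction h using Relation.ReflTransGen.head_induction_on with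
  | refl => exact absurd rfl hyx
  | @head u v huv hv ih =>
    by_cases hvx : v = x
    · refine ⟨1, expect_lt_one _ (fun z => ?_) huv (by simp [hvx])⟩
      split_ifs <;> simp
    · obtain ⟨k, hk⟩ := ih hvx
      refine ⟨k + 1, ?_⟩
      rw [Function.iterate_succ_apply']
      refine expect_lt_one _ (fun z => ?_) huv (by simpa [hvx] using hk)
      split_ifs
      · simp
      · exact taboo_iterate_one_le P x k z

/-- Starting at `x` itself does not count as a hit, so in that case one step is made first and the
path back is followed from there. -/
lemma taboo_iterate_lt_one {P : S → PMF S} {x₀ x y : S} (hP : IsIrreducibleFrom P x₀)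
    (hx : x ∈ reachable P x₀) (hy : y ∈ reachable P x₀) : ∃ k, (taboo P x)^[k] 1 y < 1 := by
  by_cases hyx : y = x
  · subst hyx
    obtain ⟨z, hz⟩ := (P y).support_nonempty
    have hz' : z ∈ reachable P x₀ := Relation.ReflTransGen.tail hy hz
    by_cases hzy : z = y
    · refine ⟨1, expect_lt_one _ (fun z => ?_) hz (by simp [hzy])⟩
      split_ifs <;> simp
    · obtain ⟨k, hk⟩ := taboo_iterate_lt_one_of_reachable (hP z hz' y hx) hzy
      refine ⟨k + 1, ?_⟩
      rw [Function.iterate_succ_apply']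
      refine expect_lt_one _ (fun z => ?_) hz (by simpa [hzy] using hk)
      split_ifs
      · simp
      · exact taboo_iterate_one_le P y k z
  · exact taboo_iterate_lt_one_of_reachable (hP y hy x hx) hyx

lemma reachable_of_mem_support {P : S → PMF S} {x₀ y z : S} (hy : y ∈ reachable P x₀)
    (hz : z ∈ (P y).support) : z ∈ reachable P x₀ :=
  Relation.ReflTransGen.tail hy hz

lemma taboo_iterate_mono_reachable {P : S → PMF S} {x₀ : S} (x : S) {u v : S → ℝ≥0∞}
    (h : ∀ z ∈ reachable P x₀, u z ≤ v z) (k : ℕ) {y : S} (hy : y ∈ reachable P x₀) :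
    (taboo P x)^[k] u y ≤ (taboo P x)^[k] v y := by
  induction k generalizing y with
  | zero => exact h y hy
  | succ k ih =>
    rw [Function.iterate_succ_apply', Function.iterate_succ_apply']
    exact taboo_mono_support P x fun z hz => ih (reachable_of_mem_support hy hz)

lemma taboo_iterate_le_of_drift {P : S → PMF S} {x₀ : S} (x : S) {V : S → ℝ≥0∞} {C : ℝ≥0∞}
    (h : ∀ y ∈ reachable P x₀, expect (P y) V ≤ V y + C) (k : ℕ) {y : S}
    (hy : y ∈ reachable P x₀) : (taboo P x)^[k] V y ≤ V y + k * C := by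
  induction k generalizing y with
  | zero => simp
  | succ k ih =>
    rw [Function.iterate_succ_apply']
    calc taboo P x ((taboo P x)^[k] V) y
        ≤ taboo P x (fun z => V z + k * C) y :=
          taboo_mono_support P x fun z hz => ih (reachable_of_mem_support hy hz)
      _ ≤ expect (P y) (fun z => V z + k * C) := taboo_le_expect P x _ y
      _ = expect (P y) V + k * C := by rw [expect_add, expect_const]
      _ ≤ V y + C + k * C := by gcongr; exact h y hy
      _ = V y + (k + 1 : ℕ) * C := by push_cast; ring

/-- Foster's criterion for the truncated return times. -/
lemma exists_truncReturn_bound {P : S → PMF S} {x₀ x : S} (hP : IsIrreducibleFrom P x₀)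
    (hx : x ∈ reachable P x₀) (V : S → ℝ≥0∞) (hV : ∀ y ∈ reachable P x₀, V y ≠ ∞)
    {C : ℝ≥0∞} (hC : C ≠ ∞) (hstep : ∀ y ∈ reachable P x₀, expect (P y) V ≤ V y + C)
    (F : Finset S) (hF : ∀ y ∈ F, y ∈ reachable P x₀)
    (hdrift : ∀ y ∈ reachable P x₀, y ∉ F → expect (P y) V + 1 ≤ V y) :
    ∃ B : ℝ≥0∞, B ≠ ∞ ∧ ∀ n, truncReturn P x n x ≤ B := by
  -- The worst truncated return time over the exceptional set; truncation keeps it finite.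
  set m : ℕ → ℝ≥0∞ := fun n => F.sup (truncReturn P x n) with hm
  have hm_mono : Monotone m := fun a b hab =>
    Finset.sup_mono_fun fun y _ => truncReturn_mono P x y hab
  have hm_top : ∀ n, m n ≠ ∞ := fun n =>
    ((Finset.sup_le fun y _ => truncReturn_le P x n y).trans_lt (ENNReal.natCast_lt_top n)).ne
  -- Outside `F`, the drift of `V` pays for each unit of time; once in `F`, at most `m n` remains.
  have key : ∀ n, ∀ y ∈ reachable P x₀, truncReturn P x n y ≤ V y + m n := by
    intro n
    induction n with
    | zero => intro y _; simp [truncReturn]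
    | succ n ih =>
      intro y hy
      by_cases hyF : y ∈ F
      · exact (Finset.le_sup (f := truncReturn P x (n + 1)) hyF).trans le_add_self
      · calc truncReturn P x (n + 1) y = 1 + taboo P x (truncReturn P x n) y :=
              truncReturn_succ P x n y
          _ ≤ 1 + taboo P x (fun z => V z + m n) y := by
              gcongr
              exact taboo_mono_support P x fun z hz => ih z (reachable_of_mem_support hy hz)
          _ ≤ 1 + expect (P y) (fun z => V z + m n) := by
              gcongr
              exact taboo_le_expect P x _ y
          _ = expect (P y) V + 1 + m n := by rw [expect_add, expect_const]; ring
          _ ≤ V y + m (n + 1) := by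
              gcongr
              · exact hdrift y hy hyF
              · exact hm_mono n.le_succ
  have hbound : ∀ y ∈ F, ∃ D : ℝ≥0∞, D ≠ ∞ ∧ ∀ n, truncReturn P x n y = m n → m n ≤ D := by
    intro y hyF
    have hy := hF y hyF
    obtain ⟨k, hk⟩ := taboo_iterate_lt_one hP hx hy
    set a := (taboo P x)^[k] 1 y with ha
    set D : ℝ≥0∞ := k + (V y + k * C) with hD
    have hD_top : D ≠ ∞ := by simp [hD, hV y hy, hC, ENNReal.mul_eq_top]
    have h1a : 1 - a ≠ 0 := (tsub_pos_of_lt hk).ne'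
    refine ⟨D / (1 - a), ENNReal.div_ne_top hD_top h1a, fun n hn => ?_⟩
    have hle : m n ≤ D + a * m n := by
      calc m n = truncReturn P x n y := hn.symm
        _ ≤ truncReturn P x (k + n) y := truncReturn_mono P x y (Nat.le_add_left n k)
        _ = truncReturn P x k y + (taboo P x)^[k] (truncReturn P x n) y :=
            truncReturn_add P x k n y
        _ ≤ k + (taboo P x)^[k] (V + m n • (1 : S → ℝ≥0∞)) y := by
            gcongr
            · exact truncReturn_le P x k y
            · refine taboo_iterate_mono_reachable x (fun z hz => ?_) k hy
              simpa using key n z hz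
        _ = k + ((taboo P x)^[k] V y + m n * a) := by
            rw [taboo_iterate_add, taboo_iterate_smul]; rfl
        _ ≤ k + (V y + k * C + m n * a) := by
            gcongr
            exact taboo_iterate_le_of_drift x hstep k hy
        _ = D + a * m n := by rw [hD]; ring
    rw [ENNReal.le_div_iff_mul_le (Or.inl h1a) (Or.inl (by simp)), mul_comm,
      ENNReal.sub_mul (fun _ _ => hm_top n), one_mul]
    exact tsub_le_iff_right.2 hle
  choose! D hD_top hD using hbound
  refine ⟨V x + F.sup D, ENNReal.add_ne_top.2 ⟨hV x hx, ?_⟩, fun n => ?_⟩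
  · exact ((Finset.sup_lt_iff (by simp)).2 fun y hy => (hD_top y hy).lt_top).ne
  · refine (key n x hx).trans ?_
    gcongr
    rcases F.eq_empty_or_nonempty with hFe | hFn
    · simp [hm, hFe]
    · obtain ⟨y, hyF, hy⟩ := Finset.exists_mem_eq_sup F hFn (truncReturn P x n)
      exact (hD y hyF n hy.symm).trans (Finset.le_sup (f := D) hyF)

-- The `n`-th product is `1` exactly while no return has occurred at times `1, …, n`, so the series
-- counts the time up to the return.
open Classical in
lemma returnTime_le_tsum (x : S) (ω : ℕ → S) :
    returnTime x ω ≤ ∑' n, ∏ i : Fin n, if ω (i + 1) = x then (0 : ℝ≥0∞) else 1 := by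
  by_cases h : ∃ n, ω (n + 1) = x
  · set N := Nat.find h
    calc returnTime x ω ≤ ((N + 1 : ℕ) : ℝ≥0∞) :=
          iInf₂_le (N + 1) ⟨Nat.le_add_left 1 N, Nat.find_spec h⟩
      _ = ∑ n ∈ Finset.range (N + 1),
            ∏ i : Fin n, if ω (i + 1) = x then (0 : ℝ≥0∞) else 1 := by
          rw [Finset.sum_congr rfl (g := fun _ => 1)]
          · simp
          · intro n hn
            refine Finset.prod_eq_one fun i _ => if_neg (Nat.find_min h ?_)
            have := Finset.mem_range.1 hn
            have := i.2
            lia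
      _ ≤ _ := ENNReal.sum_le_tsum _
  · push Not at h
    simp [h]

/-! ### From the taboo operator to the law of trajectories -/

section PathLaw

variable [MeasurableSpace S] [DiscreteMeasurableSpace S]

/-- The Markov property at time `n`: the next coordinate is integrated out given the history. -/
lemma lintegral_pathLaw_succ (P : S → PMF S) (x₀ : S) (n : ℕ)
    {f : ((i : Finset.Iic n) → S) → ℝ≥0∞} (hf : Measurable f) (w : S → ℝ≥0∞) :
    ∫⁻ ω, f (Preorder.frestrictLe n ω) * w (ω (n + 1)) ∂pathLaw P x₀
      = ∫⁻ ω, f (Preorder.frestrictLe n ω) * expect (P (ω n)) w ∂pathLaw P x₀ := by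
  have hw : Measurable w := Measurable.of_discrete
  have hPw : Measurable fun y => expect (P y) w := Measurable.of_discrete
  have hfw : Measurable fun p : ((i : Finset.Iic n) → S) × S => f p.1 * w p.2 := by fun_prop
  have h1 := Kernel.partialTraj_compProd_eq_map_traj (X := fun _ => S) (κ := stepKernel P)
    (Nat.zero_le n) (x₀ := fun _ => x₀)
  have h2 := Kernel.traj_map_frestrictLe_apply (X := fun _ => S) (κ := stepKernel P) 0 n
    (fun _ => x₀)
  calc ∫⁻ ω, f (Preorder.frestrictLe n ω) * w (ω (n + 1)) ∂pathLaw P x₀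
      = ∫⁻ p, f p.1 * w p.2 ∂((pathLaw P x₀).map
          fun ω => (Preorder.frestrictLe (π := fun _ => S) n ω, ω (n + 1))) := by
        rw [lintegral_map hfw (by fun_prop)]
    _ = ∫⁻ h, f h * expect (P (h ⟨n, Finset.mem_Iic.2 le_rfl⟩)) w
          ∂Kernel.partialTraj (X := fun _ => S) (stepKernel P) 0 n (fun _ => x₀) := by
        rw [pathLaw, ← h1, Measure.lintegral_compProd hfw]
        refine lintegral_congr fun h => ?_
        dsimp only
        rw [lintegral_const_mul _ hw, ← lintegral_toMeasure]
        rfl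
    _ = _ := by
        have hm : Measurable fun h : (i : Finset.Iic n) → S =>
            f h * expect (P (h ⟨n, Finset.mem_Iic.2 le_rfl⟩)) w :=
          hf.mul (hPw.comp (measurable_pi_apply _))
        rw [← h2, lintegral_map hm (by fun_prop)]
        rfl

open Classical in
lemma lintegral_pathLaw_taboo (P : S → PMF S) (x₀ x : S) (n : ℕ) (u : S → ℝ≥0∞) :
    ∫⁻ ω, (∏ i : Fin n, if ω (i + 1) = x then 0 else 1) * u (ω n) ∂pathLaw P x₀
      = (taboo P x)^[n] u x₀ := by
  induction n generalizing u with
  | zero =>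
    have h2 := Kernel.traj_map_frestrictLe_apply (X := fun _ => S) (κ := stepKernel P) 0 0
      (fun _ => x₀)
    have hu : Measurable u := Measurable.of_discrete
    rw [Kernel.partialTraj_self, Kernel.id_apply] at h2
    have h3 : ∫⁻ ω, u (ω 0) ∂pathLaw P x₀
        = ∫⁻ h, u (h ⟨0, Finset.mem_Iic.2 le_rfl⟩) ∂((pathLaw P x₀).map
            (Preorder.frestrictLe (π := fun _ => S) 0)) := by
      rw [lintegral_map (by fun_prop) (by fun_prop)]
      rfl
    rw [pathLaw, h2, lintegral_dirac' _ (by fun_prop)] at h3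
    simpa [pathLaw] using h3
  | succ n ih =>
    have hg : Measurable fun y : S => if y = x then (0 : ℝ≥0∞) else 1 := Measurable.of_discrete
    have hf : Measurable fun h : (i : Finset.Iic n) → S =>
        ∏ i : Fin n, if h ⟨i + 1, Finset.mem_Iic.2 i.2⟩ = x then (0 : ℝ≥0∞) else 1 :=
      Finset.measurable_prod _ fun i _ => hg.comp (measurable_pi_apply _)
    rw [Function.iterate_succ_apply, ← ih]
    have := lintegral_pathLaw_succ P x₀ n hf fun z => if z = x then 0 else u z
    refine Eq.trans (lintegral_congr fun ω => ?_) this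
    rw [Fin.prod_univ_castSucc, mul_assoc]
    congr 1
    simp [ite_mul]

lemma meanReturnTime_le {P : S → PMF S} {x : S} {B : ℝ≥0∞}
    (hB : ∀ n, truncReturn P x n x ≤ B) : meanReturnTime P x ≤ B := by
  classical
  have hmeas : ∀ n, Measurable fun ω : ℕ → S =>
      ∏ i : Fin n, if ω (i + 1) = x then (0 : ℝ≥0∞) else 1 := fun n =>
    Finset.measurable_prod _ fun i _ =>
      (Measurable.of_discrete (f := fun y : S => if y = x then (0 : ℝ≥0∞) else 1)).comp
        (measurable_pi_apply _)
  calc meanReturnTime P x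
      ≤ ∫⁻ ω, ∑' n, (∏ i : Fin n, if ω (i + 1) = x then (0 : ℝ≥0∞) else 1) ∂pathLaw P x :=
        lintegral_mono (returnTime_le_tsum x)
    _ = ∑' n, (taboo P x)^[n] 1 x := by
        rw [lintegral_tsum fun n => (hmeas n).aemeasurable]
        refine tsum_congr fun n => ?_
        rw [← lintegral_pathLaw_taboo P x x n 1]
        simp
    _ ≤ B := by
        rw [ENNReal.tsum_eq_iSup_nat]
        exact iSup_le hB

/-- **Foster's criterion** for positive recurrence. -/
theorem isPositiveRecurrentFrom_of_drift {P : S → PMF S} {x₀ : S} (hP : IsIrreducibleFrom P x₀)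
    (V : S → ℝ≥0∞) (hV : ∀ y ∈ reachable P x₀, V y ≠ ∞) {C : ℝ≥0∞} (hC : C ≠ ∞)
    (hstep : ∀ y ∈ reachable P x₀, expect (P y) V ≤ V y + C)
    (F : Set S) (hF : F.Finite)
    (hdrift : ∀ y ∈ reachable P x₀, y ∉ F → expect (P y) V + 1 ≤ V y) :
    IsPositiveRecurrentFrom P x₀ := by
  intro x hx
  obtain ⟨B, hB, hle⟩ := exists_truncReturn_bound hP hx V hV hC hstep
    (hF.inter_of_left (reachable P x₀)).toFinset (fun y hy => by simp_all)
    (fun y hy hyF => hdrift y hy fun h => hyF (by simp [h, hy]))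
  exact (meanReturnTime_le hle).trans_lt hB.lt_top

end PathLaw

end DTMC

namespace DTMC

lemma exists_expect_tsub_le {α : Type*} (μ : PMF α) (g : α → ℕ)
    (hg : expect μ (fun a => (g a : ℝ≥0∞)) ≠ ∞) {ε : ℝ≥0∞} (hε : ε ≠ 0) :
    ∃ L : ℕ, expect μ (fun a => ((g a - L : ℕ) : ℝ≥0∞)) ≤ ε := by
  obtain ⟨s, hs⟩ := ((tendsto_order.1 (ENNReal.tendsto_tsum_compl_atTop_zero hg)).2 ε
    (pos_iff_ne_zero.2 hε)).exists
  -- The finite set `s` carries all but `ε` of the mean; with `L` the maximum of `g` on `s`, the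
  -- excess vanishes on `s`.
  refine ⟨s.sup g, le_trans ?_ hs.le⟩
  refine le_of_le_of_eq ?_ (tsum_subtype {a | a ∉ s} fun a => μ a * (g a : ℝ≥0∞)).symm
  refine ENNReal.tsum_le_tsum fun a => ?_
  by_cases ha : a ∈ s
  · simp [Nat.sub_eq_zero_of_le (Finset.le_sup (f := g) ha)]
  · rw [Set.indicator_of_mem (by exact ha)]
    refine mul_le_mul_right ?_ _
    exact Nat.cast_le.2 (Nat.sub_le _ _)

end DTMC

/-! ### Token counts and the Lyapunov drift of the engine -/

namespace LLM

open DTMC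

variable {κ : Type*}

/-- Total number of unprocessed tokens of a list of requests. -/
def tokens (l : List (Request κ)) : ℕ := (l.map fun r => r.prefill + r.decode).sum

/-- The largest amount by which the number of unprocessed tokens of a request in the list
exceeds `L`. -/
def maxExcess (L : ℕ) (l : List (Request κ)) : ℕ :=
  (l.map fun r => r.prefill + r.decode - L).foldr max 0

lemma tokens_append (l l' : List (Request κ)) : tokens (l ++ l') = tokens l + tokens l' := by
  simp [tokens]

lemma tokens_filter_le (q : Request κ → Bool) (l : List (Request κ)) :
    tokens (l.filter q) ≤ tokens l := by
  induction l with
  | nil => simp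
  | cons r l ih =>
    rw [List.filter_cons]
    split_ifs <;> simp only [tokens, List.map_cons, List.sum_cons] at * <;> omega

lemma maxExcess_le_iff {L n : ℕ} {l : List (Request κ)} :
    maxExcess L l ≤ n ↔ ∀ r ∈ l, r.prefill + r.decode ≤ n + L := by
  induction l with
  | nil => simp [maxExcess]
  | cons r l ih =>
    simp only [maxExcess, List.map_cons, List.foldr_cons, max_le_iff, List.mem_cons,
      forall_eq_or_imp] at *
    rw [ih, Nat.sub_le_iff_le_add]

lemma le_maxExcess_add {L : ℕ} {l : List (Request κ)} {r : Request κ} (hr : r ∈ l) :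
    r.prefill + r.decode ≤ maxExcess L l + L :=
  maxExcess_le_iff.1 le_rfl r hr

lemma le_tokens {l : List (Request κ)} {r : Request κ} (hr : r ∈ l) :
    r.prefill + r.decode ≤ tokens l :=
  List.le_sum_of_mem (List.mem_map_of_mem hr)

/-- A single new request is bounded by the total of the new tokens, so the increase is controlled by
a tail of that total. -/
lemma maxExcess_append_le (L : ℕ) (l l' : List (Request κ)) :
    maxExcess L (l ++ l') ≤ maxExcess L l + (tokens l' - L) := by
  refine maxExcess_le_iff.2 fun r hr => ?_
  rcases List.mem_append.1 hr with h | h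
  · have := le_maxExcess_add (L := L) h
    omega
  · have := le_tokens h
    omega

/-! ### Effect of one decision -/

section Decision

variable {π : Algorithm κ} {x : State κ}

lemma tokens_eq_sum (l : List (Request κ)) :
    tokens l = ∑ i : Fin l.length, (l[i].prefill + l[i].decode) := by
  conv_lhs => rw [tokens, ← List.ofFn_getElem (xs := l), List.map_ofFn, List.sum_ofFn]
  rfl

lemma mem_postQueue {r : Request κ} (hr : r ∈ postQueue π x) :
    ∃ i : Fin x.queue.length, r.prefill = x.queue[i].prefill - (π x i).1 ∧
      r.decode = x.queue[i].decode - (π x i).2 ∧ r.decode ≠ 0 := by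
  simp only [postQueue, List.mem_filter, List.mem_ofFn, decide_eq_true_eq] at hr
  obtain ⟨⟨i, rfl⟩, h⟩ := hr
  exact ⟨i, rfl, rfl, by simpa using h⟩

lemma tokens_postQueue_add_tokenLoad_le {b : ℕ} (hf : IsFeasibleAt b π x)
    (hd : ∀ r ∈ x.queue, 1 ≤ r.decode) :
    tokens (postQueue π x) + tokenLoad π x ≤ tokens x.queue := by
  have h1 : tokens (postQueue π x) ≤ ∑ i : Fin x.queue.length,
      ((x.queue[i].prefill - (π x i).1) + (x.queue[i].decode - (π x i).2)) := by
    refine (tokens_filter_le _ _).trans (le_of_eq ?_)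
    rw [tokens, List.map_ofFn, List.sum_ofFn]
    rfl
  calc tokens (postQueue π x) + tokenLoad π x
      ≤ ∑ i : Fin x.queue.length,
          ((x.queue[i].prefill - (π x i).1) + (x.queue[i].decode - (π x i).2)
            + ((π x i).1 + (π x i).2)) := by
        rw [Finset.sum_add_distrib]
        exact Nat.add_le_add_right h1 _
    _ = tokens x.queue := by
        rw [tokens_eq_sum]
        refine Finset.sum_congr rfl fun i _ => ?_
        have := hf.prefill_le i
        have := hf.decode_le i
        have := hd x.queue[i] (List.getElem_mem _)
        omega

lemma maxExcess_postQueue_le (π : Algorithm κ) (x : State κ) (L : ℕ) :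
    maxExcess L (postQueue π x) ≤ maxExcess L x.queue := by
  refine maxExcess_le_iff.2 fun r hr => ?_
  obtain ⟨i, hp, hd, -⟩ := mem_postQueue hr
  have := le_maxExcess_add (L := L) (List.getElem_mem (l := x.queue) i.2)
  simp only [Fin.getElem_fin] at *
  omega

/-- If all loadable tokens are loaded, every request loses at least one token. -/
lemma maxExcess_postQueue_le_sub_one {b : ℕ} (hf : IsFeasibleAt b π x)
    (hd : ∀ r ∈ x.queue, 1 ≤ r.decode) (hload : tokenLoad π x = loadable x) (L : ℕ) :
    maxExcess L (postQueue π x) ≤ maxExcess L x.queue - 1 := by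
  -- Feasibility bounds each request's load by its loadable amount; equal sums force equality
  -- request by request.
  have hterm := (Finset.sum_eq_sum_iff_of_le (s := Finset.univ)
    (f := fun i => (π x i).1 + (π x i).2)
    (g := fun i => x.queue[i].prefill + if x.queue[i].prefill = 0 then 1 else 0)
    (fun i _ => by
      have h1 := hf.prefill_first i
      have h2 := hf.prefill_le i
      have h3 := hf.decode_le i
      split_ifs <;> omega)).1 hload
  refine maxExcess_le_iff.2 fun r hr => ?_
  obtain ⟨i, hrp, hrd, hr0⟩ := mem_postQueue hr
  have h0 := le_maxExcess_add (L := L) (List.getElem_mem (l := x.queue) i.2)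
  have h1 := hf.prefill_first i
  have h2 := hf.prefill_le i
  have h3 := hf.decode_le i
  have h4 := hd x.queue[i] (List.getElem_mem _)
  have h5 := hterm i (Finset.mem_univ i)
  simp only [Fin.getElem_fin] at *
  split_ifs at h5 <;> omega

lemma length_le_loadable (x : State κ) : x.queue.length ≤ loadable x := by
  calc x.queue.length = ∑ _i : Fin x.queue.length, 1 := by simp
    _ ≤ loadable x := by
      refine Finset.sum_le_sum fun i _ => ?_
      split_ifs <;> omega

/-- Each request contributes at least one loadable token, so the queue has length below `b`, with
entries from a finite set. -/
lemma finite_setOf_loadable_lt [Finite κ] (b L : ℕ) :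
    {x : State κ | x.remaining = 0 ∧ loadable x < b ∧ maxExcess L x.queue = 0}.Finite := by
  have hR : {r : Request κ | r.prefill + r.decode ≤ L}.Finite := by
    have : ((Set.univ ×ˢ Set.Iic L ×ˢ Set.Iic L ×ˢ Set.univ :
        Set (Fin 2 × ℕ × ℕ × κ))).Finite :=
      Set.finite_univ.prod ((Set.finite_Iic L).prod ((Set.finite_Iic L).prod Set.finite_univ))
    refine (this.image fun s => (⟨s.1, s.2.1, s.2.2.1, s.2.2.2⟩ : Request κ)).subset ?_
    rintro ⟨j, p, d, z⟩ h
    simp only [Set.mem_ofPred_eq] at h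
    refine ⟨(j, p, d, z), ?_, rfl⟩
    simp
    omega
  have := hR.to_subtype
  have hl : {l : List {r : Request κ | r.prefill + r.decode ≤ L} | l.length < b}.Finite :=
    List.finite_length_lt _ b
  refine (hl.image fun l => (⟨0, l.map Subtype.val⟩ : State κ)).subset ?_
  rintro ⟨r, q⟩ ⟨h1, h2, h3⟩
  have hq : ∀ r ∈ q, r.prefill + r.decode ≤ L := by
    simpa using maxExcess_le_iff.1 h3.le
  refine ⟨q.attach.map fun r => ⟨r.1, hq r.1 r.2⟩, ?_, ?_⟩
  · have := length_le_loadable (⟨r, q⟩ : State κ)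
    simp only [Set.mem_ofPred_eq, List.length_map, List.length_attach]
    exact this.trans_lt h2
  · simp only at h1
    subst h1
    simp [Function.comp_def]

end Decision

/-! ### New requests -/

namespace Engine

variable (M : Engine κ)

lemma expect_drawRequests (js : List (Fin 2)) :
    expect (M.drawRequests js) (fun l => (tokens l : ℝ≥0∞))
      = ∑ j, (js.count j : ℝ≥0∞) * (M.emeanSize j .prefill + M.emeanSize j .decode) := by
  induction js with
  | nil => simp [drawRequests, expect_pure, tokens]
  | cons i js ih =>
    have h : ∀ s : ℕ × ℕ × κ, expect ((M.drawRequests js).map fun l =>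
        (⟨i, s.1, s.2.1, s.2.2⟩ : Request κ) :: l) (fun l => (tokens l : ℝ≥0∞))
        = (s.1 + s.2.1) + expect (M.drawRequests js) (fun l => (tokens l : ℝ≥0∞)) := by
      intro s
      rw [expect_map]
      simp only [tokens, List.map_cons, List.sum_cons, Nat.cast_add, expect_add, expect_const]
    rw [drawRequests, expect_bind]
    simp only [h, ih, expect_add, expect_const]
    change M.emeanSize i .prefill + M.emeanSize i .decode + _ = _
    fin_cases i <;> simp [List.count_cons] <;> ring

lemma expect_newRequests :
    expect M.newRequests (fun l => (tokens l : ℝ≥0∞))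
      = ∑ j, M.erate j * (M.emeanSize j .prefill + M.emeanSize j .decode) := by
  rw [newRequests, expect_bind]
  simp only [expect_drawRequests, expect_sum]
  refine Finset.sum_congr rfl fun j _ => ?_
  simp only [mul_comm _ (M.emeanSize j .prefill + M.emeanSize j .decode), expect_const_mul]
  rfl

lemma one_le_decode_of_mem_drawRequests {js : List (Fin 2)} {l : List (Request κ)}
    (hl : l ∈ (M.drawRequests js).support) : ∀ r ∈ l, 1 ≤ r.decode := by
  induction js generalizing l with
  | nil => simp_all [drawRequests]
  | cons j js ih =>
    simp only [drawRequests, PMF.mem_support_bind_iff, PMF.mem_support_map_iff] at hl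
    obtain ⟨s, hs, l', hl', rfl⟩ := hl
    intro r hr
    rcases List.mem_cons.1 hr with rfl | h
    · exact M.decode_pos j s hs
    · exact ih hl' r h

lemma one_le_decode_of_mem_transition {π : Algorithm κ} {x y : State κ}
    (hy : y ∈ (M.transition π x).support) : ∀ r ∈ y.queue, 1 ≤ r.decode := by
  simp only [transition, newRequests, PMF.mem_support_map_iff, PMF.mem_support_bind_iff] at hy
  obtain ⟨l, ⟨js, -, hl⟩, rfl⟩ := hy
  intro r hr
  rcases List.mem_append.1 hr with h | h
  · obtain ⟨i, -, -, h0⟩ := mem_postQueue h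
    omega
  · exact M.one_le_decode_of_mem_drawRequests hl r h

/-- The initial state may be arbitrary, but irreducibility makes every reachable state the outcome
of some transition, and transitions only produce requests with decode tokens left. -/
lemma one_le_decode_of_reachable {π : Algorithm κ} {x₀ x : State κ}
    (hirr : IsIrreducibleFrom (M.transition π) x₀) (hx : x ∈ reachable (M.transition π) x₀) :
    ∀ r ∈ x.queue, 1 ≤ r.decode := by
  obtain ⟨y, hy⟩ := (M.transition π x).support_nonempty
  have hyx := hirr y (reachable_of_mem_support hx hy) x hx
  rcases Relation.ReflTransGen.cases_tail hyx with rfl | ⟨z, -, hz⟩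
  · exact M.one_le_decode_of_mem_transition hy
  · exact M.one_le_decode_of_mem_transition hz

/-! ### The Lyapunov function -/

/-- Total number of tokens, plus a multiple of the excess of the largest request over `L`, plus a
multiple of the remaining processing time. -/
noncomputable def lyapunov (L : ℕ) (β γ : ℝ≥0) (x : State κ) : ℝ≥0 :=
  tokens x.queue + β * maxExcess L x.queue + γ * x.remaining

/-- The effect of the decision is deterministic; `q` bounds the mean contribution of the arrivals.
-/
lemma expect_transition_lyapunov_le {L : ℕ} {β γ q : ℝ≥0}
    (hq : expect M.newRequests (fun l => (tokens l : ℝ≥0∞))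
      + β * expect M.newRequests (fun l => ((tokens l - L : ℕ) : ℝ≥0∞)) ≤ q)
    (K : ℝ≥0) (π : Algorithm κ) (x : State κ) :
    expect (M.transition π x) (fun y => ((K * lyapunov L β γ y : ℝ≥0) : ℝ≥0∞))
      ≤ ((K * (lyapunov L β γ ⟨M.nextRemaining π x, postQueue π x⟩ + q) : ℝ≥0) : ℝ≥0∞) := by
  set y₀ : State κ := ⟨M.nextRemaining π x, postQueue π x⟩ with hy₀
  have hle : ∀ l : List (Request κ),
      lyapunov L β γ ⟨M.nextRemaining π x, postQueue π x ++ l⟩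
        ≤ lyapunov L β γ y₀ + (tokens l + β * (tokens l - L : ℕ)) := by
    intro l
    have h : (maxExcess L (postQueue π x ++ l) : ℝ≥0)
        ≤ maxExcess L (postQueue π x) + (tokens l - L : ℕ) := by
      exact_mod_cast maxExcess_append_le L (postQueue π x) l
    simp only [lyapunov, hy₀, tokens_append, Nat.cast_add]
    calc _ ≤ (tokens (postQueue π x) : ℝ≥0) + tokens l
          + β * (maxExcess L (postQueue π x) + (tokens l - L : ℕ))
          + γ * M.nextRemaining π x := by gcongr
      _ = _ := by ring
  rw [transition, expect_map]
  calc _ ≤ expect M.newRequests (fun l => (K : ℝ≥0∞) * ((lyapunov L β γ y₀ : ℝ≥0)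
          + ((tokens l : ℝ≥0∞) + β * ((tokens l - L : ℕ) : ℝ≥0∞)))) := by
        refine expect_mono _ fun l => ?_
        have := mul_le_mul_right (hle l) K
        calc _ ≤ ((K * (lyapunov L β γ y₀ + (tokens l + β * (tokens l - L : ℕ))) : ℝ≥0) : ℝ≥0∞) := by
              exact ENNReal.coe_le_coe.2 this
          _ = _ := by push_cast; rfl
    _ ≤ _ := by
        rw [expect_const_mul, expect_add, expect_const, expect_add, expect_const_mul]
        rw [ENNReal.coe_mul, ENNReal.coe_add]
        gcongr

/-- Outside the finite set of states where all requests are small and a batch exhausts the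
loadable tokens, the Lyapunov function decreases. -/
lemma lyapunov_next_add_le {L : ℕ} {β γ q η : ℝ≥0} {π : Algorithm κ} {x : State κ}
    (hf : IsFeasibleAt M.budget π x) (hw : IsWorkConservingAt M.budget π x)
    (hd : ∀ r ∈ x.queue, 1 ≤ r.decode)
    (hbusy : q + η ≤ γ) (hfull : q + η + γ * M.batchTime M.budget ≤ M.budget + γ)
    (hpart : ∀ k ≤ M.budget, q + η + γ * M.batchTime k ≤ β + γ)
    (hx : ¬(x.remaining = 0 ∧ loadable x < M.budget ∧ maxExcess L x.queue = 0)) :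
    lyapunov L β γ ⟨M.nextRemaining π x, postQueue π x⟩ + q + η ≤ lyapunov L β γ x := by
  have hT := tokens_postQueue_add_tokenLoad_le hf hd
  have hX := maxExcess_postQueue_le π x L
  simp only [lyapunov, nextRemaining]
  rw [← NNReal.coe_le_coe] at hbusy hfull ⊢
  have hT' : (tokens (postQueue π x) : ℝ) + tokenLoad π x ≤ tokens x.queue := by exact_mod_cast hT
  have hX' : (β : ℝ) * maxExcess L (postQueue π x) ≤ β * maxExcess L x.queue := by gcongr
  have hl0 : (0 : ℝ) ≤ tokenLoad π x := Nat.cast_nonneg _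
  simp only [NNReal.coe_add, NNReal.coe_mul, NNReal.coe_natCast] at *
  have hnext : ∀ k, ((M.batchTime k - 1 : ℕ) : ℝ) = M.batchTime k - 1 := fun k => by
    rw [Nat.cast_sub (M.batchTime_pos k), Nat.cast_one]
  by_cases hr : 0 < x.remaining
  -- Busy slot: the remaining time drops by one, which gains `γ`.
  · rw [if_pos hr, Nat.cast_sub hr, Nat.cast_succ, Nat.cast_zero]
    linarith
  · have hr0 : x.remaining = 0 := by omega
    rw [if_neg hr, hnext, hr0]
    by_cases hb : M.budget ≤ loadable x
    -- Full batch: `b` tokens are gained, against a cost `γ (t_b - 1)`.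
    · have hload := hw.full hr0 hb
      rw [hload] at hT' ⊢
      simp only [Nat.cast_zero]
      linarith
    -- Partial batch: the excess is positive here, so it drops by one and gains `β`.
    · have hload := hw.exhaustive hr0 (not_le.1 hb)
      have hX1 := maxExcess_postQueue_le_sub_one hf hd hload L
      have hpos : maxExcess L x.queue ≠ 0 := fun h => hx ⟨hr0, not_le.1 hb, h⟩
      have hX2 : maxExcess L (postQueue π x) + 1 ≤ maxExcess L x.queue := by omega
      have hX3 : (maxExcess L (postQueue π x) : ℝ) + 1 ≤ maxExcess L x.queue := by
        exact_mod_cast hX2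
      have hX4 := mul_le_mul_of_nonneg_left hX3 β.coe_nonneg
      have hp := hpart _ hf.budget
      rw [← NNReal.coe_le_coe] at hp
      simp only [NNReal.coe_add, NNReal.coe_mul, NNReal.coe_natCast, Nat.cast_zero] at *
      linarith

/-- Crude growth bound, uniform in the state, for the bounded-increase condition of Foster's
criterion. -/
lemma lyapunov_next_le {L : ℕ} {β γ : ℝ≥0} {π : Algorithm κ} {x : State κ}
    (hf : IsFeasibleAt M.budget π x) (hd : ∀ r ∈ x.queue, 1 ≤ r.decode) :
    lyapunov L β γ ⟨M.nextRemaining π x, postQueue π x⟩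
      ≤ lyapunov L β γ x + γ * ∑ k ∈ Finset.range (M.budget + 1), (M.batchTime k : ℝ≥0) := by
  have hT : tokens (postQueue π x) ≤ tokens x.queue := by
    have := tokens_postQueue_add_tokenLoad_le hf hd
    omega
  have hX := maxExcess_postQueue_le π x L
  have hk : M.batchTime (tokenLoad π x) ≤ ∑ k ∈ Finset.range (M.budget + 1), M.batchTime k :=
    Finset.single_le_sum (f := M.batchTime) (fun _ _ => Nat.zero_le _)
      (Finset.mem_range.2 (Nat.lt_succ_of_le hf.budget))
  have hr : M.nextRemaining π x
      ≤ x.remaining + ∑ k ∈ Finset.range (M.budget + 1), M.batchTime k := by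
    rw [nextRemaining]
    split_ifs <;> omega
  have hr' : (M.nextRemaining π x : ℝ≥0)
      ≤ x.remaining + ∑ k ∈ Finset.range (M.budget + 1), (M.batchTime k : ℝ≥0) := by
    exact_mod_cast hr
  simp only [lyapunov]
  calc _ ≤ (tokens x.queue : ℝ≥0) + β * maxExcess L x.queue + γ *
        (x.remaining + ∑ k ∈ Finset.range (M.budget + 1), (M.batchTime k : ℝ≥0)) := by gcongr
    _ = _ := by ring

theorem isPositiveRecurrentFrom [Finite κ] (hM : M.FiniteMeans)
    (hload : ∑ j, M.rate j * (M.meanSize j .prefill + M.meanSize j .decode)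
      < (M.budget : ℝ) / (M.batchTime M.budget : ℝ))
    (π : Algorithm κ) (x₀ : State κ)
    (hπ : ∀ x ∈ reachable (M.transition π) x₀,
      IsFeasibleAt M.budget π x ∧ IsWorkConservingAt M.budget π x)
    (hirr : IsIrreducibleFrom (M.transition π) x₀) :
    IsPositiveRecurrentFrom (M.transition π) x₀ := by
  have hmean := M.expect_newRequests
  have hfin : ∑ j, M.erate j * (M.emeanSize j .prefill + M.emeanSize j .decode) ≠ ∞ := by
    refine ENNReal.sum_ne_top.2 fun j _ => ENNReal.mul_ne_top (hM.rate j) ?_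
    exact ENNReal.add_ne_top.2 ⟨hM.size j _, hM.size j _⟩
  set a : ℝ≥0 := (∑ j, M.erate j * (M.emeanSize j .prefill + M.emeanSize j .decode)).toNNReal
    with ha
  have ha' : expect M.newRequests (fun l => (tokens l : ℝ≥0∞)) = a := by
    rw [hmean, ha, ENNReal.coe_toNNReal hfin]
  have hareal : (a : ℝ) = ∑ j, M.rate j * (M.meanSize j .prefill + M.meanSize j .decode) := by
    rw [ha, ENNReal.coe_toNNReal_eq_toReal, ENNReal.toReal_sum fun j _ =>
      ENNReal.mul_ne_top (hM.rate j) (ENNReal.add_ne_top.2 ⟨hM.size j _, hM.size j _⟩)]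
    refine Finset.sum_congr rfl fun j _ => ?_
    rw [ENNReal.toReal_mul, ENNReal.toReal_add (hM.size j _) (hM.size j _)]
    rfl
  set c : ℝ≥0 := (M.budget : ℝ≥0) / (M.batchTime M.budget : ℝ≥0) with hc
  have hac : a < c := by
    rw [← NNReal.coe_lt_coe, hareal, hc]
    simpa using hload
  have htb : (0 : ℝ) < M.batchTime M.budget := by exact_mod_cast M.batchTime_pos M.budget
  have hcb : (c : ℝ) * M.batchTime M.budget = M.budget := by
    rw [hc]
    push_cast
    field_simp
  set t : ℝ≥0 := ∑ k ∈ Finset.range (M.budget + 1), (M.batchTime k : ℝ≥0) with ht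
  have hkt : ∀ k ≤ M.budget, (M.batchTime k : ℝ) ≤ t := fun k hk => by
    rw [ht]
    exact_mod_cast Finset.single_le_sum (f := M.batchTime) (fun _ _ => Nat.zero_le _)
      (Finset.mem_range.2 (Nat.lt_succ_of_le hk))
  -- A partial batch costs at most `γ t_k ≤ c t`; the `1` keeps `β` nonzero.
  set β : ℝ≥0 := c * t + 1 with hβ
  -- The gap `c - a = 4η` is spent as follows: `2η` on the excess caused by arrivals, `η` on the
  -- drift, and `η` as slack, so that `γ = c - η`.
  set η : ℝ≥0 := (c - a) / 4 with hη
  have hηreal : (η : ℝ) = (c - a) / 4 := by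
    rw [hη]
    push_cast [NNReal.coe_sub hac.le]
    rfl
  have hη0 : 0 < η := by
    rw [← NNReal.coe_pos, hηreal]
    have := NNReal.coe_lt_coe.2 hac
    linarith
  have hβ0 : β ≠ 0 := by positivity
  have hε : ((2 * η / β : ℝ≥0) : ℝ≥0∞) ≠ 0 := by
    rw [ENNReal.coe_ne_zero]
    positivity
  obtain ⟨L, hL⟩ := exists_expect_tsub_le M.newRequests tokens (by rw [ha']; simp) hε
  set q : ℝ≥0 := a + 2 * η with hq
  have hq' : expect M.newRequests (fun l => (tokens l : ℝ≥0∞))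
      + β * expect M.newRequests (fun l => ((tokens l - L : ℕ) : ℝ≥0∞)) ≤ q := by
    calc _ ≤ (a : ℝ≥0∞) + β * ((2 * η / β : ℝ≥0) : ℝ≥0∞) := by
          rw [ha']
          gcongr
      _ = q := by
          rw [← ENNReal.coe_mul, mul_div_cancel₀ _ hβ0, ← ENNReal.coe_add]
  set γ : ℝ≥0 := q + η with hγ
  have hqreal : (q : ℝ) = a + 2 * η := by rw [hq]; push_cast; rfl
  have hγreal : (γ : ℝ) = c - η := by
    rw [hγ]
    push_cast
    linarith
  have hγc : (γ : ℝ) ≤ c := by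
    have := η.coe_nonneg
    linarith
  have hηpos : (0 : ℝ) < η := hη0
  have hfull : q + η + γ * M.batchTime M.budget ≤ M.budget + γ := by
    rw [← NNReal.coe_le_coe]
    push_cast
    have := mul_le_mul_of_nonneg_right hγc htb.le
    linarith
  have hpart : ∀ k ≤ M.budget, q + η + γ * M.batchTime k ≤ β + γ := by
    intro k hk
    rw [← NNReal.coe_le_coe, hβ]
    push_cast
    have := mul_le_mul hγc (hkt k hk) (Nat.cast_nonneg _) c.coe_nonneg
    linarith
  have hVle := M.expect_transition_lyapunov_le (γ := γ) hq' η⁻¹ π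
  -- Scaling by `η⁻¹` turns the drift `η` into the drift `1` required by the criterion.
  refine isPositiveRecurrentFrom_of_drift hirr
    (fun x => ((η⁻¹ * lyapunov L β γ x : ℝ≥0) : ℝ≥0∞)) (fun _ _ => ENNReal.coe_ne_top)
    (C := ((η⁻¹ * (γ * t + q) : ℝ≥0) : ℝ≥0∞)) ENNReal.coe_ne_top (fun x hx => ?_)
    _ (finite_setOf_loadable_lt M.budget L) (fun x hx hxF => ?_)
  · refine (hVle x).trans ?_
    rw [← ENNReal.coe_add, ENNReal.coe_le_coe, ← mul_add]
    refine mul_le_mul_right ((add_le_add_left ?_ q).trans_eq (add_assoc _ _ _)) η⁻¹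
    exact M.lyapunov_next_le (hπ x hx).1 (M.one_le_decode_of_reachable hirr hx)
  · refine (add_le_add_left (hVle x) 1).trans ?_
    have h := M.lyapunov_next_add_le (hπ x hx).1 (hπ x hx).2
      (M.one_le_decode_of_reachable hirr hx) le_rfl hfull hpart hxF
    rw [← ENNReal.coe_one, ← ENNReal.coe_add, ENNReal.coe_le_coe]
    calc _ = η⁻¹ * (lyapunov L β γ ⟨M.nextRemaining π x, postQueue π x⟩ + q + η) := by
          rw [mul_add _ _ η, inv_mul_cancel₀ hη0.ne']
      _ ≤ _ := by gcongr

end Engine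

end LLM
-- Stability of the fluid model
namespace LLM

section Fluid

variable {rate : Fin 2 → ℝ} {m : Fin 2 → Phase → ℝ} {c : ℝ} {X : FluidPath}

/-- Total number of tokens processed in a fluid model solution. -/
def FluidPath.work (X : FluidPath) (t : ℝ) : ℝ := ∑ j, (X.B j .prefill t + X.B j .decode t)

/-- Total number of tokens that remain to be processed for the fluid present at time `t`. -/
def FluidPath.backlog (m : Fin 2 → Phase → ℝ) (X : FluidPath) (t : ℝ) : ℝ :=
  ∑ j, ((m j .prefill + m j .decode) * X.Z j .prefill t + m j .decode * X.Z j .decode t)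

namespace IsFluidSolution

variable (hX : IsFluidSolution rate m c X) (hm : ∀ j f, 0 < m j f)
include hX

lemma absolutelyContinuousOnInterval_B (j : Fin 2) (f : Phase) {s t : ℝ} (hs : 0 ≤ s)
    (hst : s ≤ t) : AbsolutelyContinuousOnInterval (X.B j f) s t := by
  refine (LipschitzOnWith.of_dist_le_mul (K := c.toNNReal) ?_).absolutelyContinuousOnInterval
  rw [Set.uIcc_of_le hst]
  have key : ∀ x y, 0 ≤ x → x ≤ y → dist (X.B j f x) (X.B j f y) ≤ c.toNNReal * dist x y := by
    intro x y hx hxy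
    have h1 := hX.B_mono j f x y hx hxy
    have h2 := hX.B_rate j f x y hx hxy
    rw [dist_comm, Real.dist_eq, abs_of_nonneg h1, dist_comm, Real.dist_eq,
      abs_of_nonneg (sub_nonneg.2 hxy), mul_comm]
    exact h2.trans (mul_le_mul_of_nonneg_left (Real.le_coe_toNNReal c) (sub_nonneg.2 hxy))
  intro x hx y hy
  rcases le_total x y with h | h
  · exact key x y (hs.trans hx.1) h
  · rw [dist_comm, dist_comm x]
    exact key y x (hs.trans hy.1) h

lemma absolutelyContinuousOnInterval_work {s t : ℝ} (hs : 0 ≤ s) (hst : s ≤ t) :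
    AbsolutelyContinuousOnInterval X.work s t := by
  have h := fun j f => hX.absolutelyContinuousOnInterval_B j f hs hst
  convert! ((h 0 .prefill).add (h 0 .decode)).add ((h 1 .prefill).add (h 1 .decode)) using 1
  funext u
  simp [FluidPath.work, Fin.sum_univ_two]

/-- All components are affine in time and `B` on `[0, ∞)`; `0 < t` makes these equations valid in a
neighbourhood. -/
lemma isRegular_of_differentiableAt {t : ℝ} (ht : 0 < t)
    (hB : ∀ j f, DifferentiableAt ℝ (X.B j f) t) : X.IsRegular t := by
  have hpos : ∀ᶠ u in nhds t, 0 ≤ u := (lt_mem_nhds ht).mono fun _ h => h.le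
  have hF : ∀ j f, DifferentiableAt ℝ (X.F j f) t := fun j f =>
    ((hB j f).const_mul (1 / m j f)).congr_of_eventuallyEq
      (hpos.mono fun u hu => hX.F_eq j f u hu)
  have hZ : ∀ j f, DifferentiableAt ℝ (X.Z j f) t := by
    intro j f
    cases f with
    | prefill =>
      refine DifferentiableAt.congr_of_eventuallyEq
        (f := fun u => X.Z j .prefill 0 + rate j * u - X.F j .prefill u) ?_
        (hpos.mono fun u hu => hX.Z_prefill j u hu)
      have := hF j .prefill
      fun_prop
    | decode =>
      refine DifferentiableAt.congr_of_eventuallyEq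
        (f := fun u => X.Z j .decode 0 + X.F j .prefill u - X.F j .decode u) ?_
        (hpos.mono fun u hu => hX.Z_decode j u hu)
      have := hF j .prefill
      have := hF j .decode
      fun_prop
  exact ⟨ht, fun j f => ⟨hB j f, hF j f,
    ((hZ j f).const_mul (m j f)).congr_of_eventuallyEq (hpos.mono fun u hu => hX.W_eq j f u hu),
    hZ j f⟩⟩

include hm

/-- Finished prefill fluid becomes decode fluid; with these weights the transfer cancels up to the
processed prefill work. -/
lemma backlog_eq {t : ℝ} (ht : 0 ≤ t) :
    X.backlog m t = X.backlog m 0 + (∑ j, rate j * (m j .prefill + m j .decode)) * t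
      - X.work t := by
  have hF : ∀ j f, m j f * X.F j f t = X.B j f t := fun j f => by
    rw [hX.F_eq j f t ht]
    field_simp [(hm j f).ne']
  simp only [FluidPath.backlog, FluidPath.work, Fin.sum_univ_two, ← hF]
  rw [hX.Z_prefill 0 t ht, hX.Z_prefill 1 t ht, hX.Z_decode 0 t ht, hX.Z_decode 1 t ht]
  ring

lemma Z_eq_zero_of_backlog_nonpos {t : ℝ} (ht : 0 ≤ t) (h : X.backlog m t ≤ 0) (j : Fin 2)
    (f : Phase) : X.Z j f t = 0 := by
  have h1 : ∀ j, 0 ≤ (m j .prefill + m j .decode) * X.Z j .prefill t := fun j =>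
    mul_nonneg (add_pos (hm j _) (hm j _)).le (hX.Z_nonneg j _ t ht)
  have h2 : ∀ j, 0 ≤ m j .decode * X.Z j .decode t := fun j =>
    mul_nonneg (hm j _).le (hX.Z_nonneg j _ t ht)
  have h3 := (Finset.sum_eq_zero_iff_of_nonneg fun j _ => add_nonneg (h1 j) (h2 j)).1
    (le_antisymm h (Finset.sum_nonneg fun j _ => add_nonneg (h1 j) (h2 j))) j (Finset.mem_univ j)
  have h4 := (add_eq_zero_iff_of_nonneg (h1 j) (h2 j)).1 h3
  cases f with
  | prefill =>
    exact (mul_eq_zero.1 h4.1).resolve_left (add_pos (hm j _) (hm j _)).ne'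
  | decode => exact (mul_eq_zero.1 h4.2).resolve_left (hm j _).ne'

lemma backlog_nonneg {t : ℝ} (ht : 0 ≤ t) : 0 ≤ X.backlog m t :=
  Finset.sum_nonneg fun j _ => add_nonneg
    (mul_nonneg (add_pos (hm j _) (hm j _)).le (hX.Z_nonneg j _ t ht))
    (mul_nonneg (hm j _).le (hX.Z_nonneg j _ t ht))

lemma workload_pos {t : ℝ} (ht : 0 ≤ t) (h : 0 < X.backlog m t) :
    0 < ∑ j, (X.W j .prefill t + X.W j .decode t) := by
  have hW : ∀ j f, 0 ≤ X.W j f t := fun j f => by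
    rw [hX.W_eq j f t ht]
    exact mul_nonneg (hm j f).le (hX.Z_nonneg j f t ht)
  by_contra hcon
  have hsum := (Finset.sum_eq_zero_iff_of_nonneg fun j _ => add_nonneg (hW j _) (hW j _)).1
    (le_antisymm (not_lt.1 hcon) (Finset.sum_nonneg fun j _ => add_nonneg (hW j _) (hW j _)))
  have hZ : ∀ j f, X.Z j f t = 0 := by
    intro j f
    have h1 := (add_eq_zero_iff_of_nonneg (hW j _) (hW j _)).1 (hsum j (Finset.mem_univ j))
    have h2 : X.W j f t = 0 := by
      cases f with
      | prefill => exact h1.1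
      | decode => exact h1.2
    rw [hX.W_eq j f t ht] at h2
    exact (mul_eq_zero.1 h2).resolve_left (hm j f).ne'
  simp [FluidPath.backlog, hZ] at h

/-- The work is Lipschitz, hence the integral of its derivative, which is `c` at almost every time
with positive backlog. -/
lemma work_sub_eq (hwc : X.IsWorkConserving c) {s t : ℝ} (hs : 0 ≤ s) (hst : s ≤ t)
    (hpos : ∀ u ∈ Set.Ioo s t, 0 < X.backlog m u) : X.work t - X.work s = c * (t - s) := by
  rw [← (hX.absolutelyContinuousOnInterval_work hs hst).integral_deriv_eq_sub]
  have hdiff : ∀ j f, ∀ᵐ u : ℝ, u ∈ Set.uIcc s t → DifferentiableAt ℝ (X.B j f) u := fun j f =>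
    (hX.absolutelyContinuousOnInterval_B j f hs hst).ae_differentiableAt
  have hae : ∀ᵐ u : ℝ, u ∈ Set.uIoc s t → deriv X.work u = c := by
    filter_upwards [hdiff 0 .prefill, hdiff 0 .decode, hdiff 1 .prefill, hdiff 1 .decode,
      MeasureTheory.Measure.ae_ne volume t] with u h1 h2 h3 h4 hut hu
    have hu' := Set.uIoc_subset_uIcc hu
    rw [Set.uIoc_of_le hst] at hu
    have hB : ∀ j f, DifferentiableAt ℝ (X.B j f) u := by
      intro j f
      fin_cases j <;> cases f
      exacts [h1 hu', h2 hu', h3 hu', h4 hu']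
    have hu0 : 0 < u := hs.trans_lt hu.1
    have hW := hX.workload_pos hm hu0.le (hpos u ⟨hu.1, lt_of_le_of_ne hu.2 hut⟩)
    rw [← hwc u (hX.isRegular_of_differentiableAt hu0 hB) hW]
    have hd : HasDerivAt X.work
        (∑ j, (deriv (X.B j .prefill) u + deriv (X.B j .decode) u)) u :=
      HasDerivAt.fun_sum fun j _ => (hB j .prefill).hasDerivAt.add (hB j .decode).hasDerivAt
    exact hd.deriv
  rw [intervalIntegral.integral_congr_ae hae, intervalIntegral.integral_const, smul_eq_mul,
    mul_comm]

lemma continuousOn_backlog {t : ℝ} (ht : 0 ≤ t) :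
    ContinuousOn (X.backlog m) (Set.Icc 0 t) := by
  have hw := (hX.absolutelyContinuousOnInterval_work le_rfl ht).continuousOn
  rw [Set.uIcc_of_le ht] at hw
  have h : ContinuousOn (fun u => X.backlog m 0
      + (∑ j, rate j * (m j .prefill + m j .decode)) * u - X.work u) (Set.Icc 0 t) := by
    fun_prop
  exact h.congr fun u hu => hX.backlog_eq hm hu.1

lemma backlog_nonpos_of_le (hwc : X.IsWorkConserving c)
    (hload : ∑ j, rate j * (m j .prefill + m j .decode) < c) {t : ℝ} (ht : 0 ≤ t)
    (h : X.backlog m 0 ≤ (c - ∑ j, rate j * (m j .prefill + m j .decode)) * t) :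
    X.backlog m t ≤ 0 := by
  by_contra! hpos
  have hdecr : ∀ s, 0 ≤ s → s ≤ t → (∀ u ∈ Set.Ioo s t, 0 < X.backlog m u) →
      X.backlog m t
        = X.backlog m s - (c - ∑ j, rate j * (m j .prefill + m j .decode)) * (t - s) := by
    intro s hs hst hu
    have := hX.work_sub_eq hm hwc hs hst hu
    rw [hX.backlog_eq hm ht, hX.backlog_eq hm hs]
    linarith
  by_cases hz : ∃ u ∈ Set.Icc 0 t, X.backlog m u = 0
  -- From the last zero `s` before `t` the backlog would decrease, so it cannot be positive at `t`.
  · have hclosed : IsClosed (Set.Icc 0 t ∩ X.backlog m ⁻¹' {0}) :=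
      (hX.continuousOn_backlog hm ht).preimage_isClosed_of_isClosed isClosed_Icc isClosed_singleton
    have hcomp : IsCompact (Set.Icc 0 t ∩ X.backlog m ⁻¹' {0}) :=
      isCompact_Icc.of_isClosed_subset hclosed Set.inter_subset_left
    obtain ⟨u, hu, hu0⟩ := hz
    obtain ⟨s, ⟨hs, hs0⟩, hmax⟩ := hcomp.exists_isGreatest ⟨u, hu, hu0⟩
    have hs0 : X.backlog m s = 0 := hs0
    have hd := hdecr s hs.1 hs.2 fun v hv =>
      lt_of_le_of_ne (hX.backlog_nonneg hm (hs.1.trans hv.1.le)) fun h0 =>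
        absurd (hmax ⟨⟨hs.1.trans hv.1.le, hv.2.le⟩, h0.symm⟩) (not_le.2 hv.1)
    have := mul_nonneg (sub_pos.2 hload).le (sub_nonneg.2 hs.2)
    linarith
  · push Not at hz
    have hd := hdecr 0 le_rfl ht fun v hv =>
      lt_of_le_of_ne (hX.backlog_nonneg hm hv.1.le) (hz v ⟨hv.1.le, hv.2.le⟩).symm
    rw [sub_zero] at hd
    linarith

end IsFluidSolution

theorem fluidModelStable_of_load_lt (hm : ∀ j f, 0 < m j f)
    (hload : ∑ j, rate j * (m j .prefill + m j .decode) < c) : FluidModelStable rate m c := by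
  set ε := c - ∑ j, rate j * (m j .prefill + m j .decode) with hε
  have hε0 : 0 < ε := sub_pos.2 hload
  set A := ∑ j, (m j .prefill + m j .decode) with hA
  have hj : ∀ j, 0 < m j .prefill + m j .decode := fun j => add_pos (hm j _) (hm j _)
  have hjA : ∀ j, m j .prefill + m j .decode ≤ A := fun j =>
    Finset.single_le_sum (f := fun j => m j .prefill + m j .decode) (fun j _ => (hj j).le)
      (Finset.mem_univ j)
  have hA0 : 0 < A := (hj 0).trans_le (hjA 0)
  -- The initial backlog is at most `A` and drains at rate `ε`.
  refine ⟨A / ε, div_pos hA0 hε0, fun X hX hwc hinit t ht j f => ?_⟩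
  have ht0 : 0 ≤ t := (div_pos hA0 hε0).le.trans ht
  have hbound : X.backlog m 0 ≤ A := by
    calc X.backlog m 0 ≤ ∑ j, A * (X.Z j .prefill 0 + X.Z j .decode 0) := by
          refine Finset.sum_le_sum fun j _ => ?_
          rw [mul_add]
          have hdA : m j .decode ≤ A := by linarith [hjA j, hm j .prefill]
          exact add_le_add
            (mul_le_mul_of_nonneg_right (hjA j) (hX.Z_nonneg j _ 0 le_rfl))
            (mul_le_mul_of_nonneg_right hdA (hX.Z_nonneg j _ 0 le_rfl))
      _ ≤ A := by
          rw [← Finset.mul_sum]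
          exact mul_le_of_le_one_right hA0.le hinit
  refine hX.Z_eq_zero_of_backlog_nonpos hm ht0 (hX.backlog_nonpos_of_le hm hwc hload ht0 ?_) j f
  calc X.backlog m 0 ≤ A := hbound
    _ = ε * (A / ε) := by field_simp
    _ ≤ ε * t := by gcongr

end Fluid

namespace Engine

lemma meanSize_pos {κ : Type*} (M : Engine κ) (hM : M.FiniteMeans) (j : Fin 2) (f : Phase) :
    0 < M.meanSize j f := by
  refine ENNReal.toReal_pos ?_ (hM.size j f)
  have h1 : (1 : ℝ≥0∞) ≤ M.emeanSize j f := by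
    rw [← DTMC.expect_const (M.sizeLaw j) 1]
    cases f with
    | prefill =>
      refine DTMC.expect_mono_support _ fun s hs => ?_
      exact_mod_cast M.prefill_pos j s hs
    | decode =>
      refine DTMC.expect_mono_support _ fun s hs => ?_
      exact_mod_cast M.decode_pos j s hs
  exact (zero_lt_one.trans_le h1).ne'

end Engine

end LLM

theorem mainTheorem3 {κ : Type*} [Finite κ] (M : LLM.Engine κ) (hM : M.FiniteMeans)
    (hload : ∑ j, M.rate j * (M.meanSize j .prefill + M.meanSize j .decode)
      < (M.budget : ℝ) / (M.batchTime M.budget : ℝ)) :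
    LLM.FluidModelStable M.rate M.meanSize M.capacity ∧
    ∀ (Kp Kd : ℕ) (π : LLM.Algorithm κ) (x₀ : LLM.State κ), 1 ≤ Kp → 1 ≤ Kd →
      (∀ x ∈ DTMC.reachable (M.transition π) x₀, LLM.IsFeasibleAt M.budget π x ∧
        LLM.IsFCFSAt Kp Kd π x ∧ LLM.IsWorkConservingAt M.budget π x) →
      DTMC.IsIrreducibleFrom (M.transition π) x₀ →
      DTMC.IsPositiveRecurrentFrom (M.transition π) x₀ :=
  ⟨LLM.fluidModelStable_of_load_lt (M.meanSize_pos hM) hload,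
    fun _ _ π x₀ _ _ hπ hirr => M.isPositiveRecurrentFrom hM hload π x₀
      (fun x hx => ⟨(hπ x hx).1, (hπ x hx).2.2⟩) hirr⟩
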